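/- **Setting.** Let $n\ge 0$, $N=\{1,\dots,n\}$, $\hat N=\{1,\dots,n+1\}$, let $\mathbf c=(c_k)_{k\in N}$ be non-negative integers, and let $\prec$ be a linear order on $N$ such that $i\prec j$ implies $c_i\le c_j$. Let $B$ be an $(n+1)$-dimensional vector space over $\mathbb Q$ and let $r^1,\dots,r^{n+1}$ be linearly independent linear functions on $B$. The graph $\mathscr G(\mathbf c)$, whose vertices are labelled by $\hat N$ and whose edges are labelled by $N$, is defined by induction on $n$ (binary fusion). For $n=0$ it is a single vertex with label $1$. For $n\ge 1$ let $s$ be the $\prec$-largest element of $N$ and let $\mathscr G(\mathbf c^-)$ be the graph of order $n-1$ attached to $\mathbf c^-=(c_k)_{k\in N\setminus\{s\}}$ with the induced order, where $N\setminus\{s\}$ is identified increasingly with $\{1,\dots,n-1\}$. Then $\mathscr G(\mathbf c)$ is the disjoint union of two copies $\mathscr G^+$, $\mathscr G^-$ of $\mathscr G(\mathbf c^-)$ together with some new edges. In both copies each edge label $i\ge s$ is replaced by $i+1$. In $\mathscr G^+$ each vertex label $i\ge s$ is replaced by $i+1$. The label in $\mathscr G^-$ of the copy $\varphi(v)$ of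 a vertex $v$ of $\mathscr G^+$ is that of $v$, except that $s+1$ is replaced by $s$. Finally, each vertex $v$ of $\mathscr G^+$ with label $s+1$ is joined to $\varphi(v)$ by an edge with label $s$. To each vertex $v$ of $\mathscr G(\mathbf c)$ is attached a linear function $z_v$ on $B$: one has $z_v-z_{v'}=c_k(r^i-r^j)$ whenever $v,v'$ have labels $i,j$ and are joined by an edge with label $k$, and $z_{v_{n+1}}=0$, where $v_{n+1}$ is the vertex with label $n+1$ of the pointed chain, that is, of the sequence of vertices $v_1,\dots,v_{n+1}$ such that $v_j$ has label $j$ and $v_{k+1},v_k$ are joined by an edge with label $k$ for every $k\in N$. Put $Z(\mathbf c)=\{z_v : v \text{ a vertex of } \mathscr G(\mathbf c)\}$. **Lemma 3.3.** Take any linear ordering on $Z(\mathbf c)$. Then $Z(\mathbf c)$ has a (unique) maximal element $z_{\max}$ with respect to that ordering, and there is $b\in B$ such that $z_{\max}(b)>z(b)$ for all $z\in Z(\mathbf c)\setminus\{z_{\max}\}$. -/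

import Mathlib

/-- A labelled graph of order `n`: vertices carry labels in `N̂ = Fin (n + 1)` and (undirected)
edges carry labels in `N = Fin n`.  `Edge k v w` says that `v` and `w` are joined by an edge
with label `k` (to which the coefficient `c k` is attached). -/
structure LabelledGraph (n : ℕ) where
  V : Type
  label : V → Fin (n + 1)
  Edge : Fin n → V → V → Prop
  symm : ∀ {k v w}, Edge k v w → Edge k w v

namespace LabelledGraph

/-- The graph of order `0`: a single vertex and no edge. -/
def point : LabelledGraph 0 where
  V := Unit
  label := fun _ => 0
  Edge := fun _ _ _ => False
  symm := fun h => h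

/-- Edges of the binary fusion of `G` at `s`; `Sum.inl v` is the vertex `v` of `G⁺` and
`Sum.inr v` is the vertex `φ(v)` of `G⁻`.  Inside each copy the edges are those of `G`, an edge
label `i` becoming `s.succAbove i` (reopening the gap at `s`).  Moreover each vertex `v` of `G⁺`
with label `s + 1` is joined to `φ(v)` by an edge with label `s`. -/
def fuseEdge {n : ℕ} (s : Fin (n + 1)) (G : LabelledGraph n) (k : Fin (n + 1)) :
    G.V ⊕ G.V → G.V ⊕ G.V → Prop
  | Sum.inl v, Sum.inl w => ∃ i, s.succAbove i = k ∧ G.Edge i v w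
  | Sum.inr v, Sum.inr w => ∃ i, s.succAbove i = k ∧ G.Edge i v w
  | Sum.inl v, Sum.inr w => k = s ∧ v = w ∧ s.castSucc.succAbove (G.label v) = s.succ
  | Sum.inr w, Sum.inl v => k = s ∧ v = w ∧ s.castSucc.succAbove (G.label v) = s.succ

/-- Binary fusion of `G` at `s`: the union of two copies `G⁺`, `G⁻` of `G`.  In `G⁺` the vertex
labels `≥ s` of `G` are increased by one, so that the label `s` is missing.  The labels in `G⁻`
are those in `G⁺`, except that `s + 1` is replaced by `s`; so the label `s + 1` is missing.
(Here `s.castSucc` and `s.succ` are the elements `s` and `s + 1` of `N̂`.) -/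
def fuse {n : ℕ} (s : Fin (n + 1)) (G : LabelledGraph n) : LabelledGraph (n + 1) where
  V := G.V ⊕ G.V
  label := Sum.elim (fun v => s.castSucc.succAbove (G.label v))
    (fun v => s.succ.succAbove (G.label v))
  Edge := G.fuseEdge s
  symm := by
    rintro k (v | v) (w | w) h
    · obtain ⟨i, hi, h⟩ := h
      exact ⟨i, hi, G.symm h⟩
    · exact h
    · exact h
    · obtain ⟨i, hi, h⟩ := h
      exact ⟨i, hi, G.symm h⟩

/-- A pointed chain: vertices `u 0, …, u n` such that `u j` has label `j`, consecutive vertices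
`u k`, `u (k + 1)` being joined by an edge with label `k`. -/
def IsPointedChain {n : ℕ} (G : LabelledGraph n) (u : Fin (n + 1) → G.V) : Prop :=
  (∀ j, G.label (u j) = j) ∧ ∀ k : Fin n, G.Edge k (u k.succ) (u k.castSucc)

/-- `z` is an evaluation of `G` with coefficients `c`, with values in the linear functions on `B`,
and with driving function zero: `z_v - z_w = c_k (r^i - r^j)` whenever `v`, `w` have labels `i`,
`j` and are joined by an edge with label `k`, and `z` vanishes on the vertex with the largest
label of a pointed chain (the distinguished vertex). -/
def IsEvaluation {n : ℕ} (G : LabelledGraph n) (c : Fin n → ℕ)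
    {B : Type*} [AddCommGroup B] [Module ℚ B] (r : Fin (n + 1) → Module.Dual ℚ B)
    (z : G.V → Module.Dual ℚ B) : Prop :=
  (∀ k v w, G.Edge k v w → z v - z w = (c k : ℚ) • (r (G.label v) - r (G.label w))) ∧
    ∃ u, G.IsPointedChain u ∧ z (u (Fin.last n)) = 0

end LabelledGraph

/-- The largest element of `Fin (n + 1)` with respect to the linear order `prec`, which need not
be the usual one. -/
def maxIndex {n : ℕ} (prec : LinearOrder (Fin (n + 1))) : Fin (n + 1) :=
  @Finset.max' (Fin (n + 1)) prec Finset.univ Finset.univ_nonempty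

/-- The linear order on `Fin n` obtained from a linear order on `Fin (n + 1)` by deleting `s` and
closing up the gap. -/
@[reducible] def eraseIndex {n : ℕ} (prec : LinearOrder (Fin (n + 1))) (s : Fin (n + 1)) :
    LinearOrder (Fin n) :=
  @LinearOrder.lift' (Fin n) (Fin (n + 1)) prec s.succAbove Fin.succAbove_right_injective

/-- The canonical graph `G(c)`, built by successive binary fusions.  It depends on `c` only through
the chosen linear order `prec` on the index set that lifts the natural order of the
coefficients. -/
def canonicalGraph : (n : ℕ) → LinearOrder (Fin n) → LabelledGraph n
  | 0, _ => LabelledGraph.point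
  | n + 1, prec =>
      (canonicalGraph n (eraseIndex prec (maxIndex prec))).fuse (maxIndex prec)

/-- The set `Z(c)` of the linear functions `z_v` attached to the vertices `v` of the canonical
graph by its evaluation with driving function zero. -/
def zSet {n : ℕ} (c : Fin n → ℕ) (prec : LinearOrder (Fin n))
    {B : Type*} [AddCommGroup B] [Module ℚ B] (r : Fin (n + 1) → Module.Dual ℚ B) :
    Set (Module.Dual ℚ B) :=
  {f | ∃ z, (canonicalGraph n prec).IsEvaluation c r z ∧ ∃ v, z v = f}

namespace LabelledGraph

/-! Up to sign and a common translation, the functions `z_v` are points on a sphere, and every point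
of a finite subset of a sphere is exposed. Each vertex `v` carries a rearrangement `y_v` of the
coefficients together with one zero, which sits at the label of `v`; crossing an edge `k` moves the
entry `c k`. Hence `z_v = C - ∑ i, y_v i • r i`, with `C` independent of `v`
(`IsWeighting.isEvaluation`, `IsEvaluation.eq_of_isWeighting`), and all `y_v` have the same norm.
Given any `v`, independence of the `r i` yields `b` with `r i b = -y_v i`. Then `z_w b = C b + ⟨y_w,
y_v⟩`, which is strictly largest where `y_w = y_v` (`sum_mul_lt_sum_sq`). The ordering only selects
an element of the finite set `Z(c)`. -/

/-- A weighting of `G` attaches to each vertex a vector that vanishes at the label of the vertex,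
in such a way that crossing an edge with label `k` transfers the entry `c k` from the label of one
end to the label of the other; moreover all these vectors have the same Euclidean norm. -/
structure IsWeighting {n : ℕ} (G : LabelledGraph n) (c : Fin n → ℕ)
    (y : G.V → Fin (n + 1) → ℚ) : Prop where
  label_eq_zero : ∀ v, y v (G.label v) = 0
  edge : ∀ {k v w}, G.Edge k v w →
    ∀ i, y w i - y v i = c k * ((if i = G.label v then 1 else 0) - if i = G.label w then 1 else 0)
  sum_sq : ∀ v w, ∑ i, y v i ^ 2 = ∑ i, y w i ^ 2

/-! ### Weightings under binary fusion -/

/-- The weighting of a fusion at `s`: the entry `c s` is inserted at `s` in `G⁺` and at `s + 1`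
in `G⁻`. -/
def fuseWeight {n : ℕ} (s : Fin (n + 1)) (G : LabelledGraph n) (a : ℚ)
    (y : G.V → Fin (n + 1) → ℚ) : (G.fuse s).V → Fin (n + 2) → ℚ :=
  Sum.elim (fun v => s.castSucc.insertNth (α := fun _ => ℚ) a (y v))
    (fun v => s.succ.insertNth (α := fun _ => ℚ) a (y v))

/-- This is the transfer along a new edge: its ends come from a vertex labelled `s`, where `y`
vanishes, so moving the inserted entry past that zero swaps just two coordinates. -/
theorem insertNth_succ_sub_insertNth_castSucc {n : ℕ} (s : Fin (n + 1)) (a : ℚ)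
    (y : Fin (n + 1) → ℚ) (hy : y s = 0) (i : Fin (n + 2)) :
    s.succ.insertNth (α := fun _ => ℚ) a y i - s.castSucc.insertNth (α := fun _ => ℚ) a y i
      = a * ((if i = s.succ then 1 else 0) - if i = s.castSucc then 1 else 0) := by
  rcases Fin.eq_self_or_eq_succAbove s.succ i with rfl | ⟨j, rfl⟩
  · have h : s.castSucc.insertNth (α := fun _ => ℚ) a y s.succ = 0 := by
      conv_lhs => rw [← Fin.succAbove_castSucc_self s]
      rw [Fin.insertNth_apply_succAbove, hy]
    have hne : s.succ ≠ s.castSucc := Fin.castSucc_lt_succ.ne'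
    simp [h, hne]
  · rw [Fin.insertNth_apply_succAbove]
    by_cases hj : j = s
    · subst hj
      rw [Fin.succAbove_succ_self, Fin.insertNth_apply_same]
      have hne : j.castSucc ≠ j.succ := Fin.castSucc_lt_succ.ne
      simp [hy, hne]
    · have h : s.succ.succAbove j = s.castSucc.succAbove j := by
        rcases lt_or_gt_of_ne hj with h | h
        · rw [Fin.succAbove_of_castSucc_lt _ _ (Fin.castSucc_lt_succ_iff.2 h.le),
            Fin.succAbove_of_castSucc_lt _ _ (Fin.castSucc_lt_castSucc_iff.2 h)]
        · rw [Fin.succAbove_of_lt_succ _ _ (Fin.succ_lt_succ_iff.2 h),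
            Fin.succAbove_of_lt_succ _ _ (Fin.castSucc_lt_succ_iff.2 h.le)]
      have h1 := Fin.succAbove_ne s.succ j
      have h2 : s.succ.succAbove j ≠ s.castSucc := h ▸ Fin.succAbove_ne s.castSucc j
      rw [if_neg h1, if_neg h2, h, Fin.insertNth_apply_succAbove]
      ring

theorem sum_insertNth_sq {n : ℕ} (p : Fin (n + 1)) (a : ℚ) (y : Fin n → ℚ) :
    ∑ i, p.insertNth (α := fun _ => ℚ) a y i ^ 2 = a ^ 2 + ∑ i, y i ^ 2 := by
  simp [Fin.sum_univ_succAbove _ p]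

theorem label_eq_of_castSucc_succAbove_eq_succ {n : ℕ} {s l : Fin (n + 1)}
    (h : s.castSucc.succAbove l = s.succ) : l = s :=
  Fin.succAbove_right_injective (h.trans (Fin.succAbove_castSucc_self s).symm)

theorem insertNth_sub_insertNth {n : ℕ} (p : Fin (n + 1)) (a b : ℚ) (x y : Fin n → ℚ)
    (l m : Fin n) (h : ∀ i, y i - x i = b * ((if i = l then 1 else 0) - if i = m then 1 else 0))
    (i : Fin (n + 1)) :
    p.insertNth (α := fun _ => ℚ) a y i - p.insertNth (α := fun _ => ℚ) a x i
      = b * ((if i = p.succAbove l then 1 else 0) - if i = p.succAbove m then 1 else 0) := by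
  rcases Fin.eq_self_or_eq_succAbove p i with rfl | ⟨j, rfl⟩
  · simp [Fin.ne_succAbove]
  · simp [h j]

theorem IsWeighting.fuse {n : ℕ} {G : LabelledGraph n} {s : Fin (n + 1)} {c : Fin (n + 1) → ℕ}
    {y : G.V → Fin (n + 1) → ℚ} (hy : G.IsWeighting (fun k => c (s.succAbove k)) y) :
    (G.fuse s).IsWeighting c (fuseWeight s G (c s) y) where
  label_eq_zero := by
    rintro (v | v)
    · simpa [LabelledGraph.fuse, fuseWeight] using hy.label_eq_zero v
    · simpa [LabelledGraph.fuse, fuseWeight] using hy.label_eq_zero v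
  edge := by
    have cross : ∀ v, s.castSucc.succAbove (G.label v) = s.succ → ∀ i,
        fuseWeight s G (c s) y (Sum.inr v) i - fuseWeight s G (c s) y (Sum.inl v) i
          = c s * ((if i = (G.fuse s).label (Sum.inl v) then 1 else 0)
            - if i = (G.fuse s).label (Sum.inr v) then 1 else 0) := by
      intro v hv i
      have hs := label_eq_of_castSucc_succAbove_eq_succ hv
      have h := insertNth_succ_sub_insertNth_castSucc s (c s) (y v)
        (by rw [← hs]; exact hy.label_eq_zero v) i
      simpa [LabelledGraph.fuse, fuseWeight, hs] using h
    rintro k (v | v) (w | w) h i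
    · obtain ⟨j, rfl, h⟩ := h
      exact insertNth_sub_insertNth _ _ _ _ _ _ _ (hy.edge h) i
    · obtain ⟨rfl, rfl, h⟩ := h
      exact cross v h i
    · obtain ⟨rfl, rfl, h⟩ := h
      linear_combination -(cross _ h i)
    · obtain ⟨j, rfl, h⟩ := h
      exact insertNth_sub_insertNth _ _ _ _ _ _ _ (hy.edge h) i
  sum_sq := by
    rintro (v | v) (w | w) <;>
      simpa [fuseWeight, sum_insertNth_sq] using hy.sum_sq v w

/-! ### Pointed chains and connectedness -/

/-- A fusion has a pointed chain if `G` has one: it runs through `G⁺` from the label `n + 1` to the label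
`s + 1`, then crosses to `G⁻`. -/
theorem IsPointedChain.exists_fuse {n : ℕ} {G : LabelledGraph n} {u : Fin (n + 1) → G.V}
    (hu : G.IsPointedChain u) (s : Fin (n + 1)) :
    ∃ u', (G.fuse s).IsPointedChain u' := by
  -- The labels `s` and `s + 1` both lie over `u s`; its two copies are the ends of the crossing
  -- edge.
  refine ⟨fun j => if j ≤ s.castSucc then Sum.inr (u (s.predAbove j))
    else Sum.inl (u (s.predAbove j)), fun j => ?_, fun k => ?_⟩
  · by_cases hj : j ≤ s.castSucc
    · have hlt : j < s.succ := hj.trans_lt Fin.castSucc_lt_succ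
      simp only [if_pos hj, LabelledGraph.fuse, Sum.elim_inr, hu.1]
      rw [Fin.predAbove_of_le_castSucc _ _ hj, Fin.succAbove_of_castSucc_lt _ _ (by simpa)]
      simp
    · have hlt : s.castSucc < j := not_le.1 hj
      simp only [if_neg hj, LabelledGraph.fuse, Sum.elim_inl, hu.1]
      rw [Fin.predAbove_of_castSucc_lt _ _ hlt, Fin.succAbove_of_lt_succ _ _ (by simpa)]
      simp
  · change G.fuseEdge s k
      (if k.succ ≤ s.castSucc then Sum.inr (u (s.predAbove k.succ))
        else Sum.inl (u (s.predAbove k.succ)))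
      (if k.castSucc ≤ s.castSucc then Sum.inr (u (s.predAbove k.castSucc))
        else Sum.inl (u (s.predAbove k.castSucc)))
    rcases Fin.eq_self_or_eq_succAbove s k with rfl | ⟨i, rfl⟩
    · rw [if_neg (not_le.2 Fin.castSucc_lt_succ), if_pos le_rfl, Fin.predAbove_succ_self,
        Fin.predAbove_castSucc_self]
      exact ⟨rfl, rfl, by rw [hu.1, Fin.succAbove_castSucc_self]⟩
    · have hi := hu.2 i
      rcases lt_or_ge i.castSucc s with h | h
      · have h1 : s.succAbove i = i.castSucc := Fin.succAbove_of_castSucc_lt _ _ h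
        have h2 : i.castSucc.succ ≤ s.castSucc := by
          rw [Fin.le_def]; rw [Fin.lt_def] at h; simp at h ⊢; omega
        have h3 : i.castSucc.castSucc ≤ s.castSucc := Fin.castSucc_le_castSucc_iff.2 h.le
        rw [h1, if_pos h2, if_pos h3, Fin.predAbove_of_le_castSucc _ _ h2,
          Fin.predAbove_of_le_castSucc _ _ h3]
        exact ⟨i, h1, hi⟩
      · have h1 : s.succAbove i = i.succ := Fin.succAbove_of_le_castSucc _ _ h
        have h2 : s.castSucc < i.succ.succ := by
          rw [Fin.lt_def]; rw [Fin.le_def] at h; simp at h ⊢; omega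
        have h3 : s.castSucc < i.succ.castSucc := by
          rw [Fin.lt_def]; rw [Fin.le_def] at h; simp at h ⊢; omega
        rw [h1, if_neg h2.not_ge, if_neg h3.not_ge, Fin.predAbove_of_castSucc_lt _ _ h2,
          Fin.predAbove_of_castSucc_lt _ _ h3]
        exact ⟨i, h1, hi⟩

/-- `G` is connected: a property that propagates along edges passes from any vertex to any other. -/
def EdgeConnected {n : ℕ} (G : LabelledGraph n) : Prop :=
  ∀ P : G.V → Prop, (∀ k v w, G.Edge k v w → P v → P w) → ∀ v w, P v → P w

theorem EdgeConnected.fuse {n : ℕ} {G : LabelledGraph n} (hG : G.EdgeConnected)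
    {s : Fin (n + 1)} {x : G.V} (hx : G.label x = s) : (G.fuse s).EdgeConnected := by
  intro P hP
  have hpp : ∀ v w, P (Sum.inl v) → P (Sum.inl w) :=
    hG (fun v => P (Sum.inl v)) fun k v w h => hP (s.succAbove k) _ _ ⟨k, rfl, h⟩
  have hmm : ∀ v w, P (Sum.inr v) → P (Sum.inr w) :=
    hG (fun v => P (Sum.inr v)) fun k v w h => hP (s.succAbove k) _ _ ⟨k, rfl, h⟩
  have hs : s.castSucc.succAbove (G.label x) = s.succ := by
    rw [hx, Fin.succAbove_castSucc_self]
  have hpm : P (Sum.inl x) → P (Sum.inr x) := hP s _ _ ⟨rfl, rfl, hs⟩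
  have hmp : P (Sum.inr x) → P (Sum.inl x) := hP s _ _ ⟨rfl, rfl, hs⟩
  rintro (v | v) (w | w) h
  · exact hpp _ _ h
  · exact hmm _ _ (hpm (hpp _ _ h))
  · exact hpp _ _ (hmp (hmm _ _ h))
  · exact hmm _ _ h

/-- Climbing the chain, the edge `k` deposits `c k` at position `k`, and later edges leave that
position alone. -/
theorem IsWeighting.apply_castSucc_of_isPointedChain {n : ℕ} {G : LabelledGraph n}
    {c : Fin n → ℕ} {y : G.V → Fin (n + 1) → ℚ} (hy : G.IsWeighting c y)
    {u : Fin (n + 1) → G.V} (hu : G.IsPointedChain u) (j : Fin (n + 1)) :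
    ∀ i : Fin n, i.castSucc < j → y (u j) i.castSucc = c i := by
  induction j using Fin.induction with
  | zero => intro i hi; exact absurd hi (Fin.not_lt_zero _)
  | succ k ih =>
    intro i hi
    have he := hy.edge (hu.2 k) i.castSucc
    rw [hu.1, hu.1, if_neg hi.ne] at he
    rcases (Fin.castSucc_lt_succ_iff.1 hi).lt_or_eq with h | rfl
    · rw [ih i (Fin.castSucc_lt_castSucc_iff.2 h),
        if_neg (Fin.castSucc_lt_castSucc_iff.2 h).ne] at he
      linarith
    · have h0 := hy.label_eq_zero (u i.castSucc)
      rw [hu.1] at h0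
      rw [h0, if_pos rfl] at he
      linarith

/-- The value does not depend on the chain, so neither does the normalization of an evaluation. -/
theorem IsWeighting.apply_last_of_isPointedChain {n : ℕ} {G : LabelledGraph n}
    {c : Fin n → ℕ} {y : G.V → Fin (n + 1) → ℚ} (hy : G.IsWeighting c y)
    {u : Fin (n + 1) → G.V} (hu : G.IsPointedChain u) :
    y (u (Fin.last n)) = Fin.snoc (α := fun _ => ℚ) (fun i => (c i : ℚ)) 0 := by
  funext i
  induction i using Fin.lastCases with
  | last =>
    have h0 := hy.label_eq_zero (u (Fin.last n))
    rw [hu.1] at h0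
    rw [h0, Fin.snoc_last]
  | cast i =>
    rw [hy.apply_castSucc_of_isPointedChain hu _ i (Fin.castSucc_lt_last i), Fin.snoc_castSucc]

/-! ### Evaluations computed from a weighting -/

section Evaluation

variable {n : ℕ} {G : LabelledGraph n} {c : Fin n → ℕ} {y : G.V → Fin (n + 1) → ℚ}
  {B : Type*} [AddCommGroup B] [Module ℚ B] {r : Fin (n + 1) → Module.Dual ℚ B}

theorem IsWeighting.sum_smul_sub (hy : G.IsWeighting c y) {k : Fin n} {v w : G.V}
    (h : G.Edge k v w) :
    ∑ i, y w i • r i - ∑ i, y v i • r i = (c k : ℚ) • (r (G.label v) - r (G.label w)) := by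
  rw [← Finset.sum_sub_distrib]
  simp only [← sub_smul, hy.edge h, mul_smul, ← Finset.smul_sum]
  simp [sub_smul]

theorem IsWeighting.isEvaluation (hy : G.IsWeighting c y) {u : Fin (n + 1) → G.V}
    (hu : G.IsPointedChain u) :
    G.IsEvaluation c r fun v => ∑ i, y (u (Fin.last n)) i • r i - ∑ i, y v i • r i :=
  ⟨fun k v w h => by rw [sub_sub_sub_cancel_left, hy.sum_smul_sub h], u, hu, sub_self _⟩

theorem IsEvaluation.eq_of_isWeighting (hy : G.IsWeighting c y) (hG : G.EdgeConnected)
    {z : G.V → Module.Dual ℚ B} (hz : G.IsEvaluation c r z) {u : Fin (n + 1) → G.V}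
    (hu : G.IsPointedChain u) (v : G.V) :
    z v = ∑ i, y (u (Fin.last n)) i • r i - ∑ i, y v i • r i := by
  obtain ⟨he, u', hu', h0⟩ := hz
  -- Replaces `u` by the chain `u'` at whose end `z` is known to vanish; the identity then spreads
  -- by connectedness.
  rw [hy.apply_last_of_isPointedChain hu, ← hy.apply_last_of_isPointedChain hu']
  refine hG (fun v => z v = ∑ i, y (u' (Fin.last n)) i • r i - ∑ i, y v i • r i) ?_
    (u' (Fin.last n)) v (by rw [h0, sub_self])
  intro k v w h hv
  have h1 := he k v w h
  rw [← hy.sum_smul_sub h, hv] at h1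
  rw [← sub_eq_zero, ← neg_eq_zero, ← sub_eq_zero.2 h1]
  abel

end Evaluation

end LabelledGraph

/-! ### The canonical graph, by induction on fusions -/

open LabelledGraph

theorem exists_isPointedChain_canonicalGraph : ∀ (n : ℕ) (prec : LinearOrder (Fin n)),
    ∃ u, (canonicalGraph n prec).IsPointedChain u
  | 0, _ => ⟨fun _ => (), fun j => (Fin.fin_one_eq_zero j).symm, fun k => k.elim0⟩
  | n + 1, prec =>
    let ⟨_, hu⟩ := exists_isPointedChain_canonicalGraph n (eraseIndex prec (maxIndex prec))
    hu.exists_fuse (maxIndex prec)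

theorem edgeConnected_canonicalGraph : ∀ (n : ℕ) (prec : LinearOrder (Fin n)),
    (canonicalGraph n prec).EdgeConnected
  | 0, _ => fun _ _ _ _ h => h
  | n + 1, prec =>
    let ⟨_, hu⟩ := exists_isPointedChain_canonicalGraph n (eraseIndex prec (maxIndex prec))
    (edgeConnected_canonicalGraph n _).fuse (hu.1 (maxIndex prec))

theorem finite_canonicalGraph : ∀ (n : ℕ) (prec : LinearOrder (Fin n)),
    Finite (canonicalGraph n prec).V
  | 0, _ => inferInstanceAs (Finite Unit)
  | n + 1, prec =>
    have := finite_canonicalGraph n (eraseIndex prec (maxIndex prec))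
    inferInstanceAs (Finite ((canonicalGraph n (eraseIndex prec (maxIndex prec))).V ⊕
      (canonicalGraph n (eraseIndex prec (maxIndex prec))).V))

theorem exists_isWeighting_canonicalGraph : ∀ (n : ℕ) (prec : LinearOrder (Fin n))
    (c : Fin n → ℕ), ∃ y, (canonicalGraph n prec).IsWeighting c y
  | 0, _, _ => ⟨fun _ _ => 0, fun _ => rfl, fun {k} => k.elim0, fun _ _ => rfl⟩
  | n + 1, prec, c =>
    let ⟨_, hy⟩ := exists_isWeighting_canonicalGraph n (eraseIndex prec (maxIndex prec))
      fun k => c ((maxIndex prec).succAbove k)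
    ⟨_, hy.fuse⟩

/-! ### Exposing a point of a sphere -/

/-- Linearly independent linear functions on a finite-dimensional space take arbitrary values. -/
theorem LinearIndependent.exists_apply_eq {K B ι : Type*} [Field K] [AddCommGroup B] [Module K B]
    [FiniteDimensional K B] {r : ι → Module.Dual K B} (hr : LinearIndependent K r) (t : ι → K) :
    ∃ b : B, ∀ i, r i b = t i := by
  obtain ⟨f, hf⟩ := LinearMap.exists_extend ((Module.Basis.span hr).constr K t)
  refine ⟨(Module.evalEquiv K B).symm f, fun i => ?_⟩
  have h := LinearMap.congr_fun hf (Module.Basis.span hr i)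
  rw [Module.Basis.constr_basis] at h
  simpa [Module.Basis.span_apply] using h

/-- Equality case of Cauchy–Schwarz: for equal norms, `0 < |x - y|² = 2(⟨y, y⟩ - ⟨x, y⟩)`. -/
theorem sum_mul_lt_sum_sq {ι : Type*} [Fintype ι] {x y : ι → ℚ} (hne : x ≠ y)
    (h : ∑ i, x i ^ 2 = ∑ i, y i ^ 2) : ∑ i, x i * y i < ∑ i, y i * y i := by
  obtain ⟨j, hj⟩ := Function.ne_iff.1 hne
  have hpos : 0 < ∑ i, (x i - y i) ^ 2 :=
    Finset.sum_pos' (fun i _ => sq_nonneg _)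
      ⟨j, Finset.mem_univ j, sq_pos_of_ne_zero (sub_ne_zero.2 hj)⟩
  have he : ∑ i, (x i - y i) ^ 2
      = ∑ i, x i ^ 2 - 2 * ∑ i, x i * y i + ∑ i, y i * y i := by
    rw [Finset.mul_sum, ← Finset.sum_sub_distrib, ← Finset.sum_add_distrib]
    exact Finset.sum_congr rfl fun i _ => by ring
  have hs : ∑ i, y i ^ 2 = ∑ i, y i * y i := Finset.sum_congr rfl fun i _ => sq (y i)
  linarith

theorem lemma3p3 {n : ℕ} (c : Fin n → ℕ) (prec : LinearOrder (Fin n))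
    (hprec : ∀ i j, prec.lt i j → c i ≤ c j)
    {B : Type*} [AddCommGroup B] [Module ℚ B] (hB : Module.finrank ℚ B = n + 1)
    (r : Fin (n + 1) → Module.Dual ℚ B) (hr : LinearIndependent ℚ r)
    (ord : LinearOrder (zSet c prec r)) :
    ∃ zmax : zSet c prec r, (∀ z : zSet c prec r, ord.le z zmax) ∧
      ∃ b : B, ∀ z : zSet c prec r, z ≠ zmax →
        (z : Module.Dual ℚ B) b < (zmax : Module.Dual ℚ B) b := by
  have : FiniteDimensional ℚ B := .of_finrank_pos (by omega)
  obtain ⟨y, hy⟩ := exists_isWeighting_canonicalGraph n prec c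
  obtain ⟨u, hu⟩ := exists_isPointedChain_canonicalGraph n prec
  have hG := edgeConnected_canonicalGraph n prec
  have := finite_canonicalGraph n prec
  let e : (canonicalGraph n prec).V → Module.Dual ℚ B := fun v =>
    ∑ i, y (u (Fin.last n)) i • r i - ∑ i, y v i • r i
  have hZ : zSet c prec r = Set.range e := by
    ext f
    constructor
    · rintro ⟨z, hz, v, rfl⟩
      exact ⟨v, (hz.eq_of_isWeighting hy hG hu v).symm⟩
    · rintro ⟨v, rfl⟩
      exact ⟨e, hy.isEvaluation hu, v, rfl⟩
  have : Finite (zSet c prec r) := (hZ ▸ Set.finite_range e).to_subtype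
  have : Nonempty (zSet c prec r) := ⟨⟨e (u 0), hZ ▸ ⟨u 0, rfl⟩⟩⟩
  obtain ⟨zmax, hmax⟩ := @Finite.exists_max _ _ _ _ ord id
  refine ⟨zmax, hmax, ?_⟩
  obtain ⟨v, hv⟩ : (zmax : Module.Dual ℚ B) ∈ Set.range e := hZ ▸ zmax.2
  -- The sign cancels the minus in `e`, so `e w b` is the inner product of `y w` and `y v` plus a
  -- constant.
  obtain ⟨b, hb⟩ := hr.exists_apply_eq fun i => -y v i
  refine ⟨b, fun z hz => ?_⟩
  obtain ⟨w, hw⟩ : (z : Module.Dual ℚ B) ∈ Set.range e := hZ ▸ z.2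
  have hne : y w ≠ y v := fun h => hz (Subtype.ext (by rw [← hw, ← hv]; simp only [e, h]))
  have hlt := sum_mul_lt_sum_sq hne (hy.sum_sq w v)
  rw [← hw, ← hv]
  simpa [e, hb] using hlt
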